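/- Let $\alpha\in\mathbb{R}$ and let $\lambda=(\lambda_1\ge\dots\ge\lambda_{r_1}\ge 1)$, $\mu=(\mu_1\ge\dots\ge\mu_{r_2}\ge 1)$ be two (possibly empty) partitions of lengths $r_1,r_2\ge 0$. Put $r=r_1+r_2$, $|\lambda|=\sum_j\lambda_j$, $|\mu|=\sum_j\mu_j$, $n_j=\lambda_j+r_1-j$ $(1\le j\le r_1)$ and $m_j=\mu_j+r_2-j$ $(1\le j\le r_2)$. Let $L^{(\alpha)}_k(x)=\frac{e^xx^{-\alpha}}{k!}\frac{d^k}{dx^k}\left(e^{-x}x^{k+\alpha}\right)$ be the Laguerre polynomial, let $$f_j(x)=L^{(\alpha)}_{n_j}(x)\ (1\le j\le r_1),\qquad f_{r_1+j}(x)=e^xL^{(\alpha)}_{m_j}(-x)\ (1\le j\le r_2),$$ and let $\mathrm{Wr}[g_1,\dots,g_k]=\det\left(g_i^{(j-1)}\right)_{1\le i,j\le k}$ denote the Wronskian. The generalized Laguerre polynomial is $$\Omega^{(\alpha)}_{\lambda,\mu}(x)=e^{-r_2x}\,\mathrm{Wr}[f_1,\dots,f_r](x).$$ Let $\mathbb{N}_{\lambda,\mu}$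 be the set of integers $n\ge 0$ with $n\ge|\lambda|+|\mu|-r_1$ and $n-|\lambda|-|\mu|\ne\lambda_j-j$ for $j=1,\dots,r_1$ (it contains all large integers). For $n\in\mathbb{N}_{\lambda,\mu}$ the exceptional Laguerre polynomial is $$L^{(\alpha)}_{\lambda,\mu,n}(x)=e^{-r_2x}\,\mathrm{Wr}\left[f_1,\dots,f_r,L^{(\alpha)}_s\right](x),\qquad s=n-|\lambda|-|\mu|+r_1.$$ Let $J_\nu$ be the Bessel function of the first kind of order $\nu$. Then $x\mapsto x^{-\frac{\alpha+r}{2}}J_{\alpha+r}(\sqrt{x})$ (principal branches, $x\neq 0$) extends to an entire function on $\mathbb{C}$, and with this extension $$\lim_{n\to\infty,\ n\in\mathbb{N}_{\lambda,\mu}}\frac{(-1)^r}{n^{\alpha+r}}L^{(\alpha)}_{\lambda,\mu,n}\left(\frac{x}{4n}\right)=\Omega^{(\alpha)}_{\lambda,\mu}(0)\,2^{\alpha+r}\,x^{-\frac{\alpha+r}{2}}J_{\alpha+r}(\sqrt{x}),$$ uniformly for $x$ in compact subsets of the complex plane. -/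

import Mathlib

open Filter Topology Polynomial
open scoped Nat

noncomputable section

/-- The Laguerre polynomial `L_n^{(α)}` for arbitrary real `α`, by its explicit expansion
`∑_{k=0}^n (-1)^k binom(n+α, n-k) x^k / k!`, where
`binom(n+α, n-k) = (α+k+1)(α+k+2)⋯(α+n) / (n-k)!`.
The Rodrigues formula is `laguerre_rodrigues`. -/
def laguerre (α : ℝ) (n : ℕ) : ℝ[X] :=
  ∑ k ∈ Finset.range (n + 1),
    C ((-1) ^ k * (ascPochhammer ℝ (n - k)).eval (α + k + 1) / ((n - k)! * k !)) * X ^ k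

/-- The Rodrigues formula `L_n^{(α)}(x) = (e^x x^{-α} / n!) dⁿ/dxⁿ (e^{-x} x^{n+α})`. -/
theorem laguerre_rodrigues (α : ℝ) (n : ℕ) {x : ℝ} (hx : 0 < x) :
    (laguerre α n).eval x =
      Real.exp x * x ^ (-α) / n ! *
        iteratedDeriv n (fun y : ℝ => Real.exp (-y) * y ^ ((n : ℝ) + α)) x := by
  have hexp (i : ℕ) : iteratedDeriv i (fun y : ℝ => Real.exp (-y)) x
      = (-1) ^ i * Real.exp (-x) := by
    rw [iteratedDeriv_comp_neg i Real.exp x, iteratedDeriv_eq_iterate, Real.iter_deriv_exp,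
      smul_eq_mul]
  have hpow (i : ℕ) : iteratedDeriv i (fun y : ℝ => y ^ ((n : ℝ) + α)) x
      = (descPochhammer ℝ i).eval ((n : ℝ) + α) * x ^ ((n : ℝ) + α - i) := by
    rw [iteratedDeriv_eq_iterate, Real.iter_deriv_rpow_const]
  have h1 : ContDiffAt ℝ n (fun y : ℝ => Real.exp (-y)) x := by fun_prop
  have h2 : ContDiffAt ℝ n (fun y : ℝ => y ^ ((n : ℝ) + α)) x :=
    Real.contDiffAt_rpow_const_of_ne hx.ne'
  rw [iteratedDeriv_fun_mul h1 h2, laguerre, eval_finsetSum, Finset.mul_sum]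
  refine Finset.sum_congr rfl fun k hk => ?_
  have hkn : k ≤ n := Nat.lt_succ_iff.mp (Finset.mem_range.mp hk)
  rw [hexp, hpow, descPochhammer_eval_eq_ascPochhammer, Nat.cast_choose ℝ hkn]
  have e1 : (n : ℝ) + α - ((n - k : ℕ) : ℝ) + 1 = α + k + 1 := by
    rw [Nat.cast_sub hkn]; ring
  have e2 : (n : ℝ) + α - ((n - k : ℕ) : ℝ) = α + k := by
    rw [Nat.cast_sub hkn]; ring
  rw [e1, e2, Real.rpow_add hx, Real.rpow_natCast, Real.rpow_neg hx.le, Real.exp_neg]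
  have hxa : x ^ α ≠ 0 := (Real.rpow_pos_of_pos hx α).ne'
  have hn : ((n)! : ℝ) ≠ 0 := by exact_mod_cast n.factorial_ne_zero
  have hk' : ((k)! : ℝ) ≠ 0 := by exact_mod_cast k.factorial_ne_zero
  have hnk : ((n - k)! : ℝ) ≠ 0 := by exact_mod_cast (n - k).factorial_ne_zero
  have hE := Real.exp_ne_zero x
  simp only [eval_mul, eval_C, eval_pow, eval_X]
  field_simp

/-- The Bessel function of the first kind of real order `ν`,
`J_ν(z) = (z/2)^ν ∑_k (-1)^k (z/2)^{2k} / (k! Γ(ν+k+1))`, with the principal branch of the power.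
`Complex.Gamma` vanishes at its poles, so `(Complex.Gamma s)⁻¹` is the entire function `1/Γ(s)`. -/
def besselJ (ν : ℝ) (z : ℂ) : ℂ :=
  (z / 2) ^ (ν : ℂ) *
    ∑' k : ℕ, (-1) ^ k * (Complex.Gamma ((ν : ℂ) + k + 1))⁻¹ / (k ! : ℂ) * (z / 2) ^ (2 * k)

/-- The Wronskian `det (d^j f_i / dx^j)`. -/
def wronskianFun {r : ℕ} (f : Fin r → ℂ → ℂ) (x : ℂ) : ℂ :=
  (Matrix.of fun i j : Fin r => iteratedDeriv (j : ℕ) (f i) x).det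

/-- A partition of length `r`: a weakly decreasing sequence of `r` positive integers. -/
def IsPartitionSeq {r : ℕ} (lam : Fin r → ℕ) : Prop :=
  Antitone lam ∧ ∀ j, 0 < lam j

/-- The degrees `n_j = λ_j + r - j` for `j = 1, …, r`; here `j` is counted from `0`. -/
def partDegree {r : ℕ} (lam : Fin r → ℕ) (j : Fin r) : ℕ :=
  lam j + (r - (j + 1))

/-- The functions `f_1, …, f_{r₁+r₂}`: first `L_{n_j}^{(α)}(x)`, then `e^x L_{m_j}^{(α)}(-x)`. -/
def laguerreSystem (α : ℝ) {r₁ r₂ : ℕ} (lam : Fin r₁ → ℕ) (mu : Fin r₂ → ℕ) :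
    Fin (r₁ + r₂) → ℂ → ℂ :=
  Fin.append
    (fun j x => aeval x (laguerre α (partDegree lam j)))
    (fun j x => Complex.exp x * aeval (-x) (laguerre α (partDegree mu j)))

/-- The generalized Laguerre polynomial `Ω_{λ,μ}^{(α)}`. -/
def generalizedLaguerre (α : ℝ) {r₁ r₂ : ℕ} (lam : Fin r₁ → ℕ) (mu : Fin r₂ → ℕ) (x : ℂ) : ℂ :=
  Complex.exp (-(r₂ * x)) * wronskianFun (laguerreSystem α lam mu) x

/-- The degree sequence `ℕ_{λ,μ}`: all `n ≥ 0` with `n ≥ |λ| + |μ| - r₁` and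
`n - |λ| - |μ| ≠ λ_j - j` for `j = 1, …, r₁`. -/
def degreeSeq {r₁ r₂ : ℕ} (lam : Fin r₁ → ℕ) (mu : Fin r₂ → ℕ) : Set ℕ :=
  {n | (∑ j, (lam j : ℤ)) + (∑ j, (mu j : ℤ)) - r₁ ≤ n ∧
    ∀ j : Fin r₁, (n : ℤ) - (∑ j, (lam j : ℤ)) - (∑ j, (mu j : ℤ)) ≠ lam j - ((j : ℕ) + 1)}

/-- All large integers belong to the degree sequence, so that `n → ∞` along it makes sense. -/
theorem eventually_mem_degreeSeq {r₁ r₂ : ℕ} (lam : Fin r₁ → ℕ) (mu : Fin r₂ → ℕ) :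
    ∀ᶠ n in atTop, n ∈ degreeSeq lam mu := by
  filter_upwards [eventually_ge_atTop (∑ j, lam j + ∑ j, mu j + ∑ j, lam j)] with n hn
  have hn' : (∑ j, (lam j : ℤ)) + (∑ j, (mu j : ℤ)) + (∑ j, (lam j : ℤ)) ≤ n := by
    exact_mod_cast hn
  have h0 : (0 : ℤ) ≤ ∑ j, (lam j : ℤ) := Finset.sum_nonneg fun _ _ => by positivity
  refine ⟨by omega, fun j hj => ?_⟩
  have h1 : (lam j : ℤ) ≤ ∑ j, (lam j : ℤ) :=
    Finset.single_le_sum (f := fun j => (lam j : ℤ)) (fun _ _ => by positivity) (Finset.mem_univ j)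
  omega

/-- The exceptional Laguerre polynomial
`L_{λ,μ,n}^{(α)}(x) = e^{-r₂ x} Wr[f_1, …, f_r, L_s^{(α)}](x)` with `s = n - |λ| - |μ| + r₁`,
which is meant for `n` in `degreeSeq lam mu` (where the subtraction does not truncate). -/
def exceptionalLaguerre (α : ℝ) {r₁ r₂ : ℕ} (lam : Fin r₁ → ℕ) (mu : Fin r₂ → ℕ) (n : ℕ)
    (x : ℂ) : ℂ :=
  Complex.exp (-(r₂ * x)) *
    wronskianFun
      (Fin.snoc (α := fun _ => ℂ → ℂ) (laguerreSystem α lam mu)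
        (fun y => aeval y (laguerre α (n + r₁ - (∑ j, lam j + ∑ j, mu j))))) x

end

/-! Expand the Wronskian along the row of `L_s^{(α)}`: it becomes a sum over `j ≤ r` of the `j`-th
derivative of `L_s^{(α)}` times a minor built from the fixed functions `f_i` (`wronskianFun_snoc`).
That derivative is `(-1)^j L_{s-j}^{(α+j)}`, so by Mehler–Heine it is `O(n^{α+j})` at `x/(4n)`.
After division by `n^{α+r}` only `j = r` survives, and its minor is the Wronskian of the `f_i`,
whose argument tends to `0`; this produces `Ω(0)` (`tendsto_wronskianFun_snoc_laguerre`).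

Mehler–Heine (`tendsto_laguerre_mehler_heine`) is a termwise limit of power series. The normalized
coefficients tend to `1/Γ(a+k+1)` by Euler's limit and are bounded uniformly in `k`, so dominated
convergence applies. Working with `1/Γ` allows every real `α`, negative integers included. Limits
are taken jointly in `(n, x)` along `atTop ×ˢ 𝓝 x₀`, which yields local uniformity because the limit
is continuous. -/

/-- Euler's limit for the reciprocal Gamma function; it also holds at the poles of `Γ`. -/
theorem tendsto_GammaSeq_inv (c : ℝ) :
    Tendsto (fun m => (Real.GammaSeq c m)⁻¹) atTop (𝓝 (Real.Gamma c)⁻¹) := by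
  by_cases h : Real.Gamma c = 0
  · obtain ⟨m, hm⟩ := (Real.Gamma_eq_zero_iff c).1 h
    rw [h, inv_zero]
    refine tendsto_const_nhds.congr' ?_
    -- At the pole `c = -m` the product in the denominator of `GammaSeq` contains the factor `c + m
    -- = 0`, so by division by zero the sequence is eventually `0`, as is its inverse.
    filter_upwards [eventually_ge_atTop m] with k hk
    have : ∏ j ∈ Finset.range (k + 1), (c + j) = 0 :=
      Finset.prod_eq_zero (Finset.mem_range.2 (Nat.lt_succ_of_le hk)) (by simp [hm])
    simp [Real.GammaSeq, this]
  · exact (Real.GammaSeq_tendsto_Gamma c).inv₀ h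

theorem ascPochhammer_eval_eq_prod_range {R : Type*} [CommSemiring R] (c : R) (n : ℕ) :
    (ascPochhammer R n).eval c = ∏ j ∈ Finset.range n, (c + j) := by
  induction n with
  | zero => simp
  | succ n ih => rw [ascPochhammer_succ_eval, ih, Finset.prod_range_succ]

theorem ascPochhammer_eval_succ_left {R : Type*} [CommSemiring R] (c : R) (n : ℕ) :
    (ascPochhammer R (n + 1)).eval c = c * (ascPochhammer R n).eval (c + 1) := by
  simp [ascPochhammer_succ_left]

/-- The rising factorial satisfies `(c)_m / (m! m^{c-1}) → 1 / Γ(c)`. -/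
theorem tendsto_ascPochhammer_div (c : ℝ) :
    Tendsto (fun m : ℕ => (ascPochhammer ℝ m).eval c / (m ! * (m : ℝ) ^ (c - 1))) atTop
      (𝓝 (Real.Gamma c)⁻¹) := by
  -- `GammaSeq` has `m + 1` factors and the rising factorial only `m`; this ratio removes the last
  -- one.
  have h1 : Tendsto (fun m : ℕ => (m : ℝ) / (m + c)) atTop (𝓝 1) :=
    tendsto_natCast_div_add_atTop c
  have h := (tendsto_GammaSeq_inv c).mul h1
  rw [mul_one] at h
  refine h.congr' ?_
  have h2 : ∀ᶠ m : ℕ in atTop, (0 : ℝ) < m + c :=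
    (tendsto_atTop_add_const_right _ c tendsto_natCast_atTop_atTop).eventually_gt_atTop 0
  filter_upwards [h2, eventually_gt_atTop 0] with m hm hm0
  have hm0' : (0 : ℝ) < m := by exact_mod_cast hm0
  have hf : (m ! : ℝ) ≠ 0 := by exact_mod_cast m.factorial_ne_zero
  have hp : (m : ℝ) ^ c ≠ 0 := (Real.rpow_pos_of_pos hm0' c).ne'
  rw [Real.GammaSeq, ascPochhammer_eval_eq_prod_range, Finset.prod_range_succ,
    Real.rpow_sub_one hm0'.ne', inv_div, add_comm c]
  field_simp

/-! ### Laguerre coefficients: limits and a uniform bound -/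

section Asymptotics

variable {N : ℕ → ℕ} {p q : ℕ}

/-- The hypothesis `N n + p = n + q` expresses `N n = n + q - p` without truncated subtraction; it
need only hold for large `n`, and the form is stable under lowering the index by a constant. -/
theorem tendsto_div_natCast_of_shift (hN : ∀ᶠ n in atTop, N n + p = n + q) (k : ℕ) :
    Tendsto (fun n : ℕ => ((N n - k : ℕ) : ℝ) / n) atTop (𝓝 1) := by
  have h : Tendsto (fun n : ℕ => 1 + ((q : ℝ) - p - k) / n) atTop (𝓝 (1 + 0)) :=
    tendsto_const_nhds.add (tendsto_const_div_atTop_nhds_zero_nat _)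
  rw [add_zero] at h
  refine h.congr' ?_
  filter_upwards [hN, eventually_ge_atTop (p + k + 1)] with n hn hn1
  have hk : k ≤ N n := by omega
  have e : (N n : ℝ) + p = n + q := by exact_mod_cast hn
  have hn0 : (n : ℝ) ≠ 0 := by
    have : n ≠ 0 := by omega
    exact_mod_cast this
  rw [Nat.cast_sub hk]
  field_simp
  linarith

theorem tendsto_atTop_of_shift (hN : ∀ᶠ n in atTop, N n + p = n + q) (k : ℕ) :
    Tendsto (fun n => N n - k) atTop atTop := by
  rw [tendsto_atTop]
  intro b
  filter_upwards [hN, eventually_ge_atTop (p + k + b)] with n hn hn1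
  omega

/-- The normalized Laguerre coefficients converge to reciprocal Gamma values. -/
theorem tendsto_laguerre_coeff (hN : ∀ᶠ n in atTop, N n + p = n + q) (a : ℝ) (k : ℕ) :
    Tendsto (fun n : ℕ => (ascPochhammer ℝ (N n - k)).eval (a + k + 1) /
      ((N n - k)! * (n : ℝ) ^ (a + k))) atTop (𝓝 (Real.Gamma (a + k + 1))⁻¹) := by
  have h1 := (tendsto_ascPochhammer_div (a + k + 1)).comp (tendsto_atTop_of_shift hN k)
  have h2 : Tendsto (fun n : ℕ => (((N n - k : ℕ) : ℝ) / n) ^ (a + k)) atTop (𝓝 1) := by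
    have := (tendsto_div_natCast_of_shift hN k).rpow_const (p := a + k) (Or.inl one_ne_zero)
    rwa [Real.one_rpow] at this
  have h := h1.mul h2
  rw [mul_one] at h
  refine h.congr' ?_
  filter_upwards [(tendsto_atTop_of_shift hN k).eventually_gt_atTop 0, eventually_gt_atTop 0]
    with n hm hn
  have hn' : (0 : ℝ) < n := by exact_mod_cast hn
  have hm' : (0 : ℝ) < ((N n - k : ℕ) : ℝ) := by exact_mod_cast hm
  have hp := (Real.rpow_pos_of_pos hm' (a + k)).ne'
  have hp' := (Real.rpow_pos_of_pos hn' (a + k)).ne'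
  rw [Real.div_rpow hm'.le hn'.le, Function.comp_apply, add_sub_cancel_right]
  field_simp

/-- The normalized Laguerre coefficients are bounded, uniformly in the index. -/
theorem exists_bound_laguerre_coeff (hN : ∀ᶠ n in atTop, N n + p = n + q) (a : ℝ) :
    ∃ D : ℝ, ∀ᶠ n : ℕ in atTop, ∀ k ≤ N n,
      |(ascPochhammer ℝ (N n - k)).eval (a + k + 1) / ((N n - k)! * (n : ℝ) ^ (a + k))| ≤ D := by
  set T : ℕ → ℕ → ℝ := fun n k =>
    (ascPochhammer ℝ (N n - k)).eval (a + k + 1) / ((N n - k)! * (n : ℝ) ^ (a + k)) with hT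
  -- Beyond `M` the coefficients decrease in `k`: `M₀` secures `a + k + 1 ≥ 1`, and the extra `q`
  -- secures `N n - k ≤ n`. The finitely many `k ≤ M` are controlled by their limits.
  obtain ⟨M₀, hM₀⟩ := exists_nat_ge (-a)
  set M := M₀ + q
  have haM : 0 ≤ a + M := by push_cast [M]; linarith [(Nat.cast_nonneg q : (0 : ℝ) ≤ q)]
  set D : ℝ := ∑ k ∈ Finset.range (M + 1), (|(Real.Gamma (a + k + 1))⁻¹| + 1) with hD
  have hlow : ∀ᶠ n in atTop, ∀ k ∈ Finset.range (M + 1), |T n k| ≤ D := by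
    rw [Filter.eventually_all_finset]
    intro k hk
    filter_upwards [(tendsto_laguerre_coeff hN a k).abs.eventually_le_const
      (lt_add_one |(Real.Gamma (a + k + 1))⁻¹|)] with n hn
    exact hn.trans (Finset.single_le_sum
      (f := fun k : ℕ => |(Real.Gamma (a + k + 1))⁻¹| + 1) (fun _ _ => by positivity) hk)
  refine ⟨D, ?_⟩
  filter_upwards [hlow, hN, eventually_gt_atTop 0] with n hn hNn hn0 k hk
  have hn' : (0 : ℝ) < n := by exact_mod_cast hn0
  rcases le_total k M with hkM | hkM
  · exact hn k (Finset.mem_range.2 (Nat.lt_succ_of_le hkM))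
  have hpos (j : ℕ) (hj : M ≤ j) : 0 ≤ T n j := by
    have hj' : (M : ℝ) ≤ j := by exact_mod_cast hj
    exact div_nonneg (ascPochhammer_pos _ _ (by linarith)).le (by positivity)
  -- With `N n - k = m + 1`, the ratio of the term at `k + 1` to the term at `k` is `(m + 1) / ((a +
  -- k + 1) n) ≤ 1`.
  have hmono : T n k ≤ T n M := by
    induction k, hkM using Nat.le_induction with
    | base => exact le_rfl
    | succ k hkM ih =>
      refine le_trans ?_ (ih (by omega))
      have hk' : (M : ℝ) ≤ k := by exact_mod_cast hkM
      obtain ⟨m, hm⟩ : ∃ m, N n - k = m + 1 := ⟨N n - k - 1, by omega⟩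
      have hm1 : N n - (k + 1) = m := by omega
      have hmn : ((m : ℝ) + 1) ≤ n := by
        have : m + 1 ≤ n := by omega
        exact_mod_cast this
      have hc : 1 ≤ a + k + 1 := by linarith
      have hA : 0 < (ascPochhammer ℝ m).eval (a + k + 1 + 1) :=
        ascPochhammer_pos _ _ (by linarith)
      simp only [hT, hm, hm1]
      rw [ascPochhammer_eval_succ_left, Nat.factorial_succ]
      push_cast
      rw [← add_assoc a, Real.rpow_add_one hn'.ne']
      have hP : 0 < (n : ℝ) ^ (a + k) := by positivity
      have hF : (0 : ℝ) < m ! := by positivity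
      rw [div_le_div_iff₀ (by positivity)
        (by positivity)]
      have h1 : (m : ℝ) + 1 ≤ (a + k + 1) * n := by nlinarith
      have h2 := mul_le_mul_of_nonneg_left h1
        (mul_pos (mul_pos hA hF) hP).le
      nlinarith
  rw [abs_of_nonneg (hpos k hkM)]
  exact hmono.trans ((le_abs_self _).trans (hn M (Finset.self_mem_range_succ M)))

end Asymptotics

/-- These values are limits of normalized coefficients with `N = id`, so they inherit the uniform
bound. -/
theorem exists_bound_Gamma_inv (a : ℝ) : ∃ D : ℝ, ∀ k : ℕ, |(Real.Gamma (a + k + 1))⁻¹| ≤ D := by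
  have hN : ∀ᶠ n in atTop, id n + 0 = n + 0 := Eventually.of_forall fun _ => rfl
  obtain ⟨D, hD⟩ := exists_bound_laguerre_coeff hN a
  refine ⟨D, fun k => le_of_tendsto (tendsto_laguerre_coeff hN a k).abs ?_⟩
  filter_upwards [hD, eventually_ge_atTop k] with n hn hk using hn k hk

/-! ### The entire Bessel series -/

/-- The entire function `∑_k (-1)^k (x/4)^k / (k! Γ(a+k+1))`, equal to
`2^a x^{-a/2} J_a(√x)`. -/
noncomputable def besselEntire (a : ℝ) (x : ℂ) : ℂ :=
  ∑' k : ℕ, ((Real.Gamma (a + k + 1))⁻¹ : ℝ) * ((-1) ^ k / (k ! : ℂ) * (x / 4) ^ k)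

/-- The coefficient `T` is left free so that one majorant serves both the limit series and the
Laguerre polynomials. -/
theorem norm_besselEntire_term_le {T D R : ℝ} {x : ℂ} (hT : |T| ≤ D) (hx : ‖x‖ ≤ R) (k : ℕ) :
    ‖(T : ℂ) * ((-1) ^ k / (k ! : ℂ) * (x / 4) ^ k)‖ ≤ D * (R ^ k / k !) := by
  have hD : 0 ≤ D := (abs_nonneg _).trans hT
  have hx4 : ‖x / 4‖ ≤ R := by
    rw [norm_div]
    have : ‖(4 : ℂ)‖ = 4 := by simp
    rw [this]
    linarith [norm_nonneg x]
  have : ‖((-1) ^ k / (k ! : ℂ) * (x / 4) ^ k)‖ ≤ R ^ k / k ! := by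
    rw [norm_mul, norm_div, norm_pow, norm_pow, norm_neg, norm_one, one_pow, Complex.norm_natCast,
      one_div_mul_eq_div]
    gcongr
  rw [norm_mul, Complex.norm_real, Real.norm_eq_abs]
  exact mul_le_mul hT this (norm_nonneg _) hD

theorem differentiable_besselEntire (a : ℝ) : Differentiable ℂ (besselEntire a) := by
  obtain ⟨D, hD⟩ := exists_bound_Gamma_inv a
  intro x₀
  have h : DifferentiableOn ℂ (besselEntire a) (Metric.ball 0 (‖x₀‖ + 1)) :=
    Complex.differentiableOn_tsum_of_summable_norm
      ((Real.summable_pow_div_factorial (‖x₀‖ + 1)).mul_left D)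
      (fun k => by fun_prop) Metric.isOpen_ball
      (fun k x hx => norm_besselEntire_term_le (hD k) (mem_ball_zero_iff.1 hx).le k)
  exact h.differentiableAt (Metric.isOpen_ball.mem_nhds (by simp))

theorem besselJ_sqrt (a : ℝ) {x : ℂ} (hx : x ≠ 0) :
    2 ^ (a : ℂ) * (x ^ (-((a : ℂ) / 2)) * besselJ a (x ^ (1 / 2 : ℂ))) = besselEntire a x := by
  have hs : (x ^ (1 / 2 : ℂ)) ^ 2 = x := by
    simp
  have hpow : (x ^ (1 / 2 : ℂ) / 2) ^ (a : ℂ) = x ^ ((a : ℂ) / 2) / 2 ^ (a : ℂ) := by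
    have h1 : (x ^ (1 / 2 : ℂ)) ^ (a : ℂ) = x ^ ((a : ℂ) / 2) := by
      -- Halving the argument keeps it in `(-π, π]`, so the principal powers compose with no branch
      -- correction.
      have him : (Complex.log x * (1 / 2)).im = x.arg / 2 := by
        rw [show Complex.log x * (1 / 2) = Complex.log x / ((2 : ℝ) : ℂ) by push_cast; ring,
          Complex.div_ofReal_im, Complex.log_im]
      rw [← Complex.cpow_mul _ (by rw [him]; linarith [Complex.neg_pi_lt_arg x, Real.pi_pos])
        (by rw [him]; linarith [Complex.arg_le_pi x, Real.pi_pos])]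
      congr 1; ring
    have h2 : x ^ (1 / 2 : ℂ) = (2 : ℝ) * (x ^ (1 / 2 : ℂ) / 2) := by push_cast; ring
    have h3 : (x ^ (1 / 2 : ℂ)) ^ (a : ℂ) = 2 ^ (a : ℂ) * (x ^ (1 / 2 : ℂ) / 2) ^ (a : ℂ) := by
      have hne : x ^ (1 / 2 : ℂ) / 2 ≠ 0 := by simp [hx]
      conv_lhs => rw [h2]
      rw [Complex.cpow_def_of_ne_zero (by simpa using hx), Complex.log_ofReal_mul two_pos hne,
        add_mul, Complex.exp_add, Complex.cpow_def_of_ne_zero hne,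
        Complex.cpow_def_of_ne_zero two_ne_zero, Complex.ofReal_log zero_le_two]
      norm_num
    have h20 : (2 : ℂ) ^ (a : ℂ) ≠ 0 := by simp [Complex.cpow_eq_zero_iff]
    rw [eq_div_iff h20, ← h1, h3, mul_comm]
  have h20 : (2 : ℂ) ^ (a : ℂ) ≠ 0 := by simp [Complex.cpow_eq_zero_iff]
  have hxa : x ^ ((a : ℂ) / 2) ≠ 0 := by simp [Complex.cpow_eq_zero_iff, hx]
  rw [besselJ, hpow, Complex.cpow_neg, besselEntire]
  have hsum : ∀ k : ℕ, (-1) ^ k * (Complex.Gamma ((a : ℂ) + k + 1))⁻¹ / (k ! : ℂ) *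
      (x ^ (1 / 2 : ℂ) / 2) ^ (2 * k) =
      ((Real.Gamma (a + k + 1))⁻¹ : ℝ) * ((-1) ^ k / (k ! : ℂ) * (x / 4) ^ k) := by
    intro k
    rw [pow_mul, div_pow, hs, Complex.ofReal_inv, ← Complex.Gamma_ofReal]
    push_cast
    norm_num
    ring
  simp_rw [hsum]
  field_simp

/-! ### Mehler–Heine asymptotics -/

/-- The Mehler–Heine formula for Laguerre polynomials. -/
theorem tendsto_laguerre_mehler_heine {N : ℕ → ℕ} {p q : ℕ}
    (hN : ∀ᶠ n in atTop, N n + p = n + q) (a : ℝ) (x₀ : ℂ) :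
    Tendsto (fun z : ℕ × ℂ => aeval (z.2 / (4 * z.1)) (laguerre a (N z.1)) / (z.1 : ℂ) ^ (a : ℂ))
      (atTop ×ˢ 𝓝 x₀) (𝓝 (besselEntire a x₀)) := by
  obtain ⟨D, hD⟩ := exists_bound_laguerre_coeff hN a
  set T : ℕ → ℕ → ℝ := fun n k =>
    (ascPochhammer ℝ (N n - k)).eval (a + k + 1) / ((N n - k)! * (n : ℝ) ^ (a + k)) with hT
  -- The polynomial is extended by zero to a full series, so that dominated convergence for `tsum`
  -- applies.
  set F : ℕ × ℂ → ℕ → ℂ := fun z k =>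
    if k ∈ Finset.range (N z.1 + 1) then
      (T z.1 k : ℂ) * ((-1) ^ k / (k ! : ℂ) * (z.2 / 4) ^ k) else 0 with hF
  have hlim : Tendsto (fun z => ∑' k, F z k) (atTop ×ˢ 𝓝 x₀) (𝓝 (besselEntire a x₀)) := by
    refine tendsto_tsum_of_dominated_convergence
      (bound := fun k => |D| * ((‖x₀‖ + 1) ^ k / k !))
      ((Real.summable_pow_div_factorial (‖x₀‖ + 1)).mul_left |D|) (fun k => ?_) ?_
    · have h1 : Tendsto (fun z : ℕ × ℂ => (T z.1 k : ℂ)) (atTop ×ˢ 𝓝 x₀)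
          (𝓝 (((Real.Gamma (a + k + 1))⁻¹ : ℝ) : ℂ)) :=
        (Complex.continuous_ofReal.tendsto _).comp
          ((tendsto_laguerre_coeff hN a k).comp tendsto_fst)
      have h2 : Tendsto (fun z : ℕ × ℂ => (-1) ^ k / (k ! : ℂ) * (z.2 / 4) ^ k) (atTop ×ˢ 𝓝 x₀)
          (𝓝 ((-1) ^ k / (k ! : ℂ) * (x₀ / 4) ^ k)) :=
        ((by fun_prop : Continuous fun y : ℂ => (-1) ^ k / (k ! : ℂ) * (y / 4) ^ k).tendsto
          x₀).comp tendsto_snd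
      refine (h1.mul h2).congr' ?_
      filter_upwards [tendsto_fst.eventually
        ((tendsto_atTop_of_shift hN 0).eventually_ge_atTop k)] with z hz
      rw [hF]
      exact (if_pos (Finset.mem_range.2 (Nat.lt_succ_of_le hz))).symm
    · filter_upwards [tendsto_fst.eventually hD, tendsto_snd.eventually
        (continuous_norm.tendsto x₀ |>.eventually_le_const (lt_add_one ‖x₀‖))] with z hz hx k
      by_cases hk : k ∈ Finset.range (N z.1 + 1)
      · simp only [hF, if_pos hk]
        exact norm_besselEntire_term_le
          ((hz k (Nat.lt_succ_iff.1 (Finset.mem_range.1 hk))).trans (le_abs_self D)) hx k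
      · simp only [hF, if_neg hk, norm_zero]
        positivity
  refine hlim.congr' ?_
  filter_upwards [tendsto_fst.eventually (eventually_gt_atTop 0)] with z hz
  have hz' : (0 : ℝ) < z.1 := by exact_mod_cast hz
  have hzc : (z.1 : ℂ) ≠ 0 := by exact_mod_cast hz.ne'
  have hza : (z.1 : ℂ) ^ (a : ℂ) ≠ 0 := by simp [Complex.cpow_eq_zero_iff, hzc]
  rw [tsum_eq_sum (s := Finset.range (N z.1 + 1)) (fun k hk => if_neg hk), laguerre, map_sum,
    Finset.sum_div]
  refine Finset.sum_congr rfl fun k hk => ?_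
  simp only [if_pos hk, hT, map_mul, aeval_C, map_pow, aeval_X, Complex.coe_algebraMap]
  rw [Real.rpow_add_natCast hz'.ne', div_pow, div_pow, mul_pow]
  push_cast
  rw [Complex.ofReal_cpow hz'.le, Complex.ofReal_natCast]
  have hf1 : ((N z.1 - k)! : ℂ) ≠ 0 := by exact_mod_cast Nat.factorial_ne_zero _
  have hf2 : (k ! : ℂ) ≠ 0 := by exact_mod_cast Nat.factorial_ne_zero _
  field_simp

theorem derivative_laguerre_succ (α : ℝ) (n : ℕ) :
    derivative (laguerre α (n + 1)) = -laguerre (α + 1) n := by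
  rw [laguerre, laguerre, derivative_sum, Finset.sum_range_succ', ← Finset.sum_neg_distrib]
  simp only [derivative_C_mul_X_pow, Nat.cast_zero, mul_zero, C_0, zero_mul, add_zero]
  refine Finset.sum_congr rfl fun k _ => ?_
  rw [Nat.add_sub_add_right, Nat.add_sub_cancel, ← neg_mul, ← C_neg, Nat.factorial_succ]
  congr 2
  have hf1 : ((n - k)! : ℝ) ≠ 0 := by exact_mod_cast Nat.factorial_ne_zero _
  have hf2 : (k ! : ℝ) ≠ 0 := by exact_mod_cast Nat.factorial_ne_zero _
  have e : α + ((k + 1 : ℕ) : ℝ) + 1 = α + 1 + k + 1 := by push_cast; ring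
  rw [e]
  push_cast
  field_simp
  ring

theorem iterate_derivative_laguerre (α : ℝ) (n j : ℕ) :
    derivative^[j] (laguerre α (n + j)) = (-1) ^ j * laguerre (α + j) n := by
  induction j generalizing α with
  | zero => simp
  | succ j ih =>
    rw [Function.iterate_succ_apply, ← add_assoc, derivative_laguerre_succ, iterate_derivative_neg,
      ih, pow_succ, show α + 1 + (j : ℝ) = α + (j + 1 : ℕ) by push_cast; ring]
    ring

theorem iteratedDeriv_aeval (P : ℝ[X]) (j : ℕ) :
    iteratedDeriv j (fun x : ℂ => aeval x P) = fun x => aeval x (derivative^[j] P) := by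
  induction j with
  | zero => simp
  | succ j ih =>
    rw [iteratedDeriv_succ, ih, Function.iterate_succ_apply']
    funext x
    exact Polynomial.deriv_aeval _

/-- The Mehler–Heine formula for the derivatives of Laguerre polynomials. -/
theorem tendsto_iteratedDeriv_laguerre {N : ℕ → ℕ} {p q : ℕ}
    (hN : ∀ᶠ n in atTop, N n + p = n + q) (a : ℝ) (j : ℕ) (x₀ : ℂ) :
    Tendsto (fun z : ℕ × ℂ => iteratedDeriv j (fun y : ℂ => aeval y (laguerre a (N z.1)))
        (z.2 / (4 * z.1)) / (z.1 : ℂ) ^ ((a + j : ℝ) : ℂ))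
      (atTop ×ˢ 𝓝 x₀) (𝓝 ((-1) ^ j * besselEntire (a + j) x₀)) := by
  -- Differentiating `j` times lowers the degree by `j`, which replaces the shift `p` by `p + j`.
  have hN' : ∀ᶠ n in atTop, (N n - j) + (p + j) = n + q := by
    filter_upwards [hN, eventually_ge_atTop (p + j)] with n hn hn1
    omega
  refine ((tendsto_laguerre_mehler_heine hN' (a + j) x₀).const_mul ((-1) ^ j)).congr' ?_
  filter_upwards [tendsto_fst.eventually hN, tendsto_fst.eventually (eventually_ge_atTop (p + j))]
    with z hz hz1
  obtain ⟨m, hm⟩ : ∃ m, N z.1 = m + j := ⟨N z.1 - j, by omega⟩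
  rw [iteratedDeriv_aeval, hm, iterate_derivative_laguerre, Nat.add_sub_cancel, mul_div_assoc']
  simp

/-! ### Expansion of the Wronskian along its last row -/

/-- The minor of the Wronskian matrix of `f_1, …, f_r, g` obtained by deleting the row of `g` and
the column of the `j`-th derivatives. -/
noncomputable def wronskianMinor {r : ℕ} (f : Fin r → ℂ → ℂ) (j : Fin (r + 1)) (x : ℂ) : ℂ :=
  (Matrix.of fun i k : Fin r => iteratedDeriv (j.succAbove k : ℕ) (f i) x).det

theorem wronskianMinor_last {r : ℕ} (f : Fin r → ℂ → ℂ) :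
    wronskianMinor f (Fin.last r) = wronskianFun f := by
  funext x
  simp [wronskianMinor, wronskianFun]

theorem wronskianFun_snoc {r : ℕ} (f : Fin r → ℂ → ℂ) (g : ℂ → ℂ) (x : ℂ) :
    wronskianFun (Fin.snoc (α := fun _ => ℂ → ℂ) f g) x =
      ∑ j : Fin (r + 1), (-1) ^ (r + j : ℕ) * iteratedDeriv j g x * wronskianMinor f j x := by
  rw [wronskianFun, Matrix.det_succ_row _ (Fin.last r)]
  refine Finset.sum_congr rfl fun j _ => ?_
  congr 1
  · simp
  · rw [wronskianMinor]
    congr 1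
    ext i k
    simp [Matrix.submatrix_apply]

theorem continuous_wronskianMinor {r : ℕ} {f : Fin r → ℂ → ℂ} (hf : ∀ i, ContDiff ℂ ⊤ (f i))
    (j : Fin (r + 1)) : Continuous (wronskianMinor f j) :=
  Continuous.matrix_det (continuous_matrix fun i _ => (hf i).continuous_iteratedDeriv _ le_top)

theorem contDiff_laguerreSystem (α : ℝ) {r₁ r₂ : ℕ} (lam : Fin r₁ → ℕ) (mu : Fin r₂ → ℕ)
    (i : Fin (r₁ + r₂)) : ContDiff ℂ ⊤ (laguerreSystem α lam mu i) := by
  have hP (P : ℝ[X]) : ContDiff ℂ ⊤ fun x : ℂ => aeval x P := P.contDiff_aeval ⊤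
  induction i using Fin.addCases with
  | left i => simpa [laguerreSystem] using hP _
  | right i =>
    simp only [laguerreSystem, Fin.append_right]
    exact Complex.contDiff_exp.mul ((hP _).comp contDiff_neg)

theorem tendsto_div_natCast_prod (x₀ : ℂ) :
    Tendsto (fun z : ℕ × ℂ => z.2 / (4 * z.1)) (atTop ×ˢ 𝓝 x₀) (𝓝 0) := by
  have h1 : Tendsto (fun z : ℕ × ℂ => z.2 / 4) (atTop ×ˢ 𝓝 x₀) (𝓝 (x₀ / 4)) :=
    tendsto_snd.div_const 4
  have h2 : Tendsto (fun z : ℕ × ℂ => (z.1 : ℂ)⁻¹) (atTop ×ˢ 𝓝 x₀) (𝓝 0) :=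
    tendsto_inv_atTop_nhds_zero_nat.comp tendsto_fst
  simpa [div_eq_mul_inv, mul_inv, mul_assoc, mul_comm, mul_left_comm] using h1.mul h2

/-- Mehler–Heine asymptotics of a Wronskian whose last function is a Laguerre polynomial. -/
theorem tendsto_wronskianFun_snoc_laguerre {r : ℕ} {f : Fin r → ℂ → ℂ}
    (hf : ∀ i, ContDiff ℂ ⊤ (f i)) {N : ℕ → ℕ} {p q : ℕ}
    (hN : ∀ᶠ n in atTop, N n + p = n + q) (a : ℝ) (x₀ : ℂ) :
    Tendsto (fun z : ℕ × ℂ => (-1) ^ r / (z.1 : ℂ) ^ ((a + r : ℝ) : ℂ) *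
        wronskianFun (Fin.snoc (α := fun _ => ℂ → ℂ) f
          (fun y => aeval y (laguerre a (N z.1)))) (z.2 / (4 * z.1)))
      (atTop ×ˢ 𝓝 x₀) (𝓝 (wronskianFun f 0 * besselEntire (a + r) x₀)) := by
  have hminor (j : Fin (r + 1)) :
      Tendsto (fun z : ℕ × ℂ => wronskianMinor f j (z.2 / (4 * z.1))) (atTop ×ˢ 𝓝 x₀)
        (𝓝 (wronskianMinor f j 0)) :=
    ((continuous_wronskianMinor hf j).tendsto 0).comp (tendsto_div_natCast_prod x₀)
  -- Splitting `n^{a+r} = n^{a+j} n^{r-j}`, the first factor normalizes the `j`-th derivative and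
  -- the second kills every term with `j < r`.
  have hterm (j : Fin (r + 1)) :
      Tendsto (fun z : ℕ × ℂ => (-1) ^ r * (-1) ^ (r + j : ℕ) *
        (iteratedDeriv j (fun y : ℂ => aeval y (laguerre a (N z.1))) (z.2 / (4 * z.1)) /
          (z.1 : ℂ) ^ ((a + j : ℝ) : ℂ)) * ((z.1 : ℂ)⁻¹ ^ (r - j : ℕ)) *
          wronskianMinor f j (z.2 / (4 * z.1))) (atTop ×ˢ 𝓝 x₀)
        (𝓝 (if j = Fin.last r then wronskianFun f 0 * besselEntire (a + r) x₀ else 0)) := by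
    have hinv : Tendsto (fun z : ℕ × ℂ => (z.1 : ℂ)⁻¹ ^ (r - j : ℕ)) (atTop ×ˢ 𝓝 x₀)
        (𝓝 (0 ^ (r - j : ℕ))) :=
      (tendsto_inv_atTop_nhds_zero_nat.comp tendsto_fst).pow _
    have h := (((tendsto_iteratedDeriv_laguerre hN a j x₀).const_mul
      ((-1) ^ r * (-1) ^ (r + j : ℕ))).mul hinv).mul (hminor j)
    convert h using 2
    split_ifs with hj
    · subst hj
      -- For `j = r` the signs are `(-1)^r` from the prefactor, `(-1)^{r+r}` from the cofactor and
      -- `(-1)^r` from the derivative; they cancel.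
      have h1 : ((-1 : ℂ) ^ r) * (-1) ^ r = 1 := by rw [← mul_pow]; simp
      rw [wronskianMinor_last, Fin.val_last, Nat.sub_self, pow_zero, pow_add]
      linear_combination (-(1 + (-1 : ℂ) ^ r * (-1) ^ r)) * wronskianFun f 0 *
        besselEntire (a + r) x₀ * h1
    · have hlt : (j : ℕ) < r := Fin.val_lt_last hj
      rw [zero_pow (by omega)]
      ring
  have hsum := tendsto_finsetSum Finset.univ fun j (_ : j ∈ Finset.univ) => hterm j
  rw [Finset.sum_ite_eq' Finset.univ (Fin.last r), if_pos (Finset.mem_univ _)] at hsum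
  refine hsum.congr' ?_
  filter_upwards [tendsto_fst.eventually (eventually_gt_atTop 0)] with z hz
  have hzc : (z.1 : ℂ) ≠ 0 := by exact_mod_cast hz.ne'
  rw [wronskianFun_snoc, Finset.mul_sum]
  refine Finset.sum_congr rfl fun j _ => ?_
  have hj : (j : ℕ) ≤ r := Nat.lt_succ_iff.1 j.2
  have hpow : (z.1 : ℂ) ^ ((a + r : ℝ) : ℂ) =
      (z.1 : ℂ) ^ ((a + j : ℝ) : ℂ) * (z.1 : ℂ) ^ (r - j : ℕ) := by
    rw [← Complex.cpow_natCast, ← Complex.cpow_add _ _ hzc]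
    congr 1
    push_cast [Nat.cast_sub hj]
    ring
  have h0 : (z.1 : ℂ) ^ ((a + j : ℝ) : ℂ) ≠ 0 := by simp [Complex.cpow_eq_zero_iff, hzc]
  rw [hpow, inv_pow]
  field_simp

/-! ### Local uniformity and conclusion -/

/-- Continuous convergence to a continuous limit is locally uniform convergence. -/
theorem tendstoLocallyUniformly_of_tendsto_prod {ι X Y : Type*} [TopologicalSpace X]
    [UniformSpace Y] {F : ι → X → Y} {f : X → Y} {l : Filter ι} (hf : Continuous f)
    (h : ∀ x, Tendsto (fun z : ι × X => F z.1 z.2) (l ×ˢ 𝓝 x) (𝓝 (f x))) :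
    TendstoLocallyUniformly F f l := by
  rw [tendstoLocallyUniformly_iff_forall_tendsto]
  intro x
  have h1 : Tendsto (fun z : ι × X => f z.2) (l ×ˢ 𝓝 x) (𝓝 (f x)) :=
    (hf.tendsto x).comp tendsto_snd
  exact (h1.prodMk_nhds (h x)).mono_right (nhds_le_uniformity (f x))

theorem mainTheorem3 (α : ℝ) {r₁ r₂ : ℕ} (lam : Fin r₁ → ℕ) (mu : Fin r₂ → ℕ)
    (hlam : IsPartitionSeq lam) (hmu : IsPartitionSeq mu) :
    ∃ E : ℂ → ℂ, Differentiable ℂ E ∧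
      (∀ x : ℂ, x ≠ 0 →
        E x = x ^ (-(((α + (r₁ + r₂) : ℝ) : ℂ) / 2)) *
          besselJ (α + (r₁ + r₂)) (x ^ (1 / 2 : ℂ))) ∧
      ∀ K : Set ℂ, IsCompact K →
        TendstoUniformlyOn
          (fun (n : ℕ) (x : ℂ) =>
            (-1) ^ (r₁ + r₂) / (n : ℂ) ^ ((α + (r₁ + r₂) : ℝ) : ℂ) *
              exceptionalLaguerre α lam mu n (x / (4 * n)))
          (fun x : ℂ =>
            generalizedLaguerre α lam mu 0 * 2 ^ ((α + (r₁ + r₂) : ℝ) : ℂ) * E x)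
          (atTop ⊓ 𝓟 (degreeSeq lam mu)) K := by
  set ν : ℝ := α + (r₁ + r₂) with hν
  have h2 : (2 : ℂ) ^ (ν : ℂ) ≠ 0 := by simp [Complex.cpow_eq_zero_iff]
  -- `besselEntire` already contains the factor `2^ν`, which is divided out here.
  refine ⟨fun x => ((2 : ℂ) ^ (ν : ℂ))⁻¹ * besselEntire ν x,
    (differentiable_besselEntire ν).const_mul _, fun x hx => ?_, ?_⟩
  · simp only [← besselJ_sqrt ν hx, inv_mul_cancel_left₀ h2]
  rw [← tendstoLocallyUniformly_iff_forall_isCompact]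
  refine tendstoLocallyUniformly_of_tendsto_prod
    (((differentiable_besselEntire ν).continuous.const_mul _).const_mul _) fun x₀ => ?_
  -- The limit holds along all `n → ∞`, so the restriction to the degree sequence can be dropped.
  refine Tendsto.mono_left ?_ (Filter.prod_mono_left _ inf_le_left)
  -- The degree `s` is a shift of `n` with `p = |λ| + |μ|` and `q = r₁`, once `n` is large enough
  -- for the subtraction not to truncate.
  have hN : ∀ᶠ n in atTop, (n + r₁ - (∑ j, lam j + ∑ j, mu j)) + (∑ j, lam j + ∑ j, mu j) =
      n + r₁ := by
    filter_upwards [eventually_ge_atTop (∑ j, lam j + ∑ j, mu j)] with n hn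
    omega
  have hW := tendsto_wronskianFun_snoc_laguerre (contDiff_laguerreSystem α lam mu) hN α x₀
  have hexp : Tendsto (fun z : ℕ × ℂ => Complex.exp (-(r₂ * (z.2 / (4 * z.1)))))
      (atTop ×ˢ 𝓝 x₀) (𝓝 (Complex.exp (-(r₂ * 0)))) :=
    ((by fun_prop : Continuous fun y : ℂ => Complex.exp (-(r₂ * y))).tendsto 0).comp
      (tendsto_div_natCast_prod x₀)
  have hcast : α + ((r₁ + r₂ : ℕ) : ℝ) = ν := by rw [hν]; push_cast; ring
  rw [hcast] at hW
  convert hexp.mul hW using 2 with z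
  · rw [exceptionalLaguerre]
    ring
  · rw [generalizedLaguerre]
    field_simp
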